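/- Let $\mathcal K$ be a locally presentable category and let $\mathcal X$ be a (small) set of morphisms of $\mathcal K$. Let $\mathcal X^{\square}$ be the class of all morphisms $g\colon C\to D$ of $\mathcal K$ having the right lifting property with respect to every $f\colon A\to B$ in $\mathcal X$, i.e. such that for all $u\colon A\to C$ and $v\colon B\to D$ with $gu=vf$ there is $d\colon B\to C$ with $df=u$ and $gd=v$. Regard $\mathcal X^{\square}$ as a full subcategory of the category $\mathcal K^{\to}$ whose objects are the morphisms of $\mathcal K$ and whose morphisms are the commutative squares. Then $\mathcal X^{\square}$ is cone-reflective in $\mathcal K^{\to}$, that is, it satisfies the solution-set condition at every object: for every object $k$ of $\mathcal K^{\to}$ there is a (small) set of morphisms $(f_i\colon k\to \ell_i)_{i\in I}$ in $\mathcal K^{\to}$ with each $\ell_i$ in $\mathcal X^{\square}$ such that every morphism $h\colon k\to \ell$ in $\mathcal K^{\to}$ with $\ell$ in $\mathcal X^{\square}$ factorizes as $h=g f_i$ for some $i\in I$ and some $g\colon \ell_i\to \ell$. -/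

import Mathlib

open CategoryTheory

universe w v u

/-- A full subcategory of `D` (given by the property `L` of its objects) satisfies the
*solution-set condition* at the object `K` of `D` if there is a `w`-small family of morphisms
`f i : K ⟶ B i` with all `B i` in `L` such that every morphism `h : K ⟶ Y` with `Y` in `L`
factorizes through some `f i`. Here `Type w` is the universe of the small sets. -/
def SolutionSetConditionAt {D : Type u} [Category.{v} D]
    (L : ObjectProperty D) (K : D) : Prop :=
  ∃ (ι : Type w) (B : ι → D) (f : ∀ i, K ⟶ B i),
    (∀ i, L (B i)) ∧
      ∀ (Y : D), L Y → ∀ h : K ⟶ Y, ∃ (i : ι) (g : B i ⟶ Y), f i ≫ g = h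

/-- A full subcategory of `D` is *cone-reflective* in `D` if it satisfies the solution-set
condition at each object of `D`. -/
def IsConeReflective {D : Type u} [Category.{v} D] (L : ObjectProperty D) : Prop :=
  ∀ K : D, SolutionSetConditionAt.{w} L K

/-- The full subcategory of the category of morphisms `Arrow C` whose objects are the morphisms
belonging to the class `W`. -/
def arrowsIn {C : Type u} [Category.{v} C] (W : MorphismProperty C) :
    ObjectProperty (Arrow C) :=
  fun f => W f.hom

/-! The small object argument factors `k` as `p ∘ i`, with `p` in `X.rlp` and `i` lifting against
`X.rlp`. The square `(i, 𝟙) : k ⟶ p` is then a weak reflection, so one arrow suffices. -/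

/-- Any small family of presentable objects consists of `κ`-presentable
objects for some regular cardinal `κ`. -/
lemma exists_isRegular_forall_isCardinalPresentable {C : Type u} [Category.{v} C]
    {ι : Type*} [Small.{w} ι] (A : ι → C) [∀ i, IsPresentable.{w} (A i)] :
    ∃ (κ : Cardinal.{w}) (_ : Fact κ.IsRegular), ∀ i, IsCardinalPresentable (A i) κ := by
  choose κ hκ hA using fun i ↦ Functor.IsAccessible.exists_cardinal.{w}
    (F := coyoneda.obj (Opposite.op (A i)))
  -- `(κ i).ord.ToType` serves only as a set of cardinality `κ i`.
  obtain ⟨κ', hκ', h⟩ := HasCardinalLT.exists_regular_cardinal_forall.{w}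
    (fun i ↦ (κ i).ord.ToType)
  have : Fact κ'.IsRegular := ⟨hκ'⟩
  refine ⟨κ', inferInstance, fun i ↦ ?_⟩
  have hle : κ i ≤ κ' := le_of_lt (by simpa [hasCardinalLT_iff_cardinal_mk_lt] using h i)
  exact isCardinalPresentable_of_le (A i) hle

/-- Any small class of morphisms in a locally presentable category permits the small object
argument. -/
lemma hasSmallObjectArgument_of_isLocallyPresentable {C : Type u} [Category.{v} C]
    [IsLocallyPresentable.{w} C] (X : MorphismProperty C) [MorphismProperty.IsSmall.{w} X] :
    MorphismProperty.HasSmallObjectArgument.{w} X := by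
  obtain ⟨κ₀, _, _⟩ := IsLocallyPresentable.exists_cardinal.{w} C
  have : LocallySmall.{w} C := HasCardinalFilteredGenerator.toLocallySmall κ₀
  have : Limits.HasColimitsOfSize.{w, w} C :=
    IsCardinalLocallyPresentable.toHasColimitsOfSize κ₀
  have : Limits.HasFiniteColimits C := Limits.hasFiniteColimits_of_hasColimitsOfSize.{w, w} C
  obtain ⟨κ, hκ, hX⟩ := exists_isRegular_forall_isCardinalPresentable.{w}
    (fun f : X.toSet ↦ f.1.left)
  have : Nonempty κ.ord.ToType := by simpa using hκ.out.ne_zero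
  have := WellFoundedLT.toOrderBot κ.ord.ToType
  exact ⟨κ, inferInstance, inferInstance,
    { preservesColimit {A B _ _} i hi f hf := by
        have : IsCardinalPresentable A κ := hX ⟨Arrow.mk i, hi⟩
        -- `κ` is regular, so `κ.ord` is `κ`-filtered.
        have := preservesColimitsOfShape_of_isCardinalPresentable A κ κ.ord.ToType
        infer_instance }⟩

/-- If every morphism factors as a morphism with the left lifting property against `W` followed
by a morphism in `W`, then any `f` has a weak reflection in the category of arrows in `W`. -/
lemma isConeReflective_arrowsIn {C : Type u} [Category.{v} C] (W : MorphismProperty C)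
    [MorphismProperty.HasFactorization W.llp W] :
    IsConeReflective.{w} (arrowsIn W) := by
  intro k
  let d := MorphismProperty.factorizationData W.llp W k.hom
  refine ⟨PUnit, fun _ ↦ Arrow.mk d.p, fun _ ↦ Arrow.homMk d.i (𝟙 _) (by simp), fun _ ↦ d.hp,
    fun Y hY h ↦ ⟨⟨⟩, ?_⟩⟩
  have := d.hi Y.hom hY
  -- The diagonal of this square is the left leg of the map `d.p ⟶ Y`.
  have sq : CommSq h.left d.i Y.hom (d.p ≫ h.right) := ⟨by simp⟩
  exact ⟨Arrow.homMk sq.lift h.right (by simp), by ext <;> simp⟩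

theorem corollary3p6 {C : Type u} [Category.{v} C] [IsLocallyPresentable.{w} C]
    (X : MorphismProperty C) [MorphismProperty.IsSmall.{w} X] :
    IsConeReflective.{w} (arrowsIn X.rlp) := by
  have := hasSmallObjectArgument_of_isLocallyPresentable.{w} X
  exact isConeReflective_arrowsIn X.rlp
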